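/- Consider a bandit problem with arms $1,\dots,K$ and an arbitrary parameter set $\Theta$. Under the parameter $\theta\in\Theta$ the rewards of arm $k$ have law $\nu_k(\theta)$ on $\mathbb R$, with mean $\mu_k(\theta)$ and sub-Gaussian with a common variance proxy $\sigma^2$; arm $k$'s reward law is determined by its mean, i.e. $\mu_k(\theta)=\mu_k(\lambda)$ implies $\nu_k(\theta)=\nu_k(\lambda)$. The functions $\mu_k$ are otherwise arbitrary. An algorithm $\pi$ chooses, possibly at random, the arm $k_t$ of round $t$ from the arms and rewards of the earlier rounds, and $\mathrm{Reg}^\pi(T,\theta)=\mathbb E_\theta\big[\sum_{t=1}^T(\max_\ell\mu_\ell(\theta)-\mu_{k_t}(\theta))\big]$ is its expected regret. It is uniformly good if $\mathrm{Reg}^\pi(T,\theta)=o(T^a)$ for all $a>0$ and all $\theta\in\Theta$. Fix $\theta^*\in\Theta$ at which the optimal arm $k^*$ is unique, and let $\Theta^*=\{\theta\in\Theta:\mu_{k^*}(\theta)=\mu_{k^*}(\theta^*)\}$. An arm $k$ is $\Theta^*$-competitive if $\mu_k(\theta)=\max_\ell\mu_\ell(\theta)$ for some $\theta\in\Theta^*$;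 let $\tilde C(\theta^*)$ be the number of such arms. Let $\Lambda(\theta^*)=\{\lambda\in\Theta^*:\mu_{k^*}(\lambda)<\max_\ell\mu_\ell(\lambda)\}$ and $$L(\theta^*)=\inf\Big\{\sum_{k}\eta(k)\big(\max_\ell\mu_\ell(\theta^*)-\mu_k(\theta^*)\big)\;:\;\eta\in[0,\infty)^K,\ \sum_{k}\eta(k)\,D\big(\nu_k(\theta^*)\,\|\,\nu_k(\lambda)\big)\ge 1\ \text{ for all }\lambda\in\Lambda(\theta^*)\Big\}\in[0,\infty],$$ where $D$ is the Kullback--Leibler divergence (with $0\cdot\infty=0$). Then: 1. For every uniformly good algorithm $\pi$, $\displaystyle\liminf_{T\to\infty}\frac{\mathrm{Reg}^\pi(T,\theta^*)}{\log T}\ge L(\theta^*)$. 2. If $\tilde C(\theta^*)=1$, then $L(\theta^*)=0$. 3. Suppose that at every $\theta\in\Theta^*$ at which $k^*$ is optimal it is the only optimal arm, and that $D(\nu_k(\theta^*)\|\nu_k(\theta))<\infty$ for all $k$ and all $\theta\in\Theta^*$. If $\tilde C(\theta^*)>1$, then $L(\theta^*)>0$. Consequently, a uniformly good algorithm with bounded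 regret $\sup_T\mathrm{Reg}^\pi(T,\theta^*)<\infty$ exists only if $\tilde C(\theta^*)=1$. -/

import Mathlib

open MeasureTheory ProbabilityTheory Filter Asymptotics InformationTheory
open scoped ENNReal NNReal

noncomputable section

namespace StructuredBandit

/-- A history of `t` rounds: the arm pulled and the reward observed in each round. -/
abbrev History (K t : ℕ) : Type := Fin t → Fin K × ℝ

/-- A (possibly randomized) bandit algorithm with `K` arms: in round `t + 1` it draws an arm from
a distribution that depends measurably on the arms and rewards of the first `t` rounds.
It has no access to the hidden parameter. -/
structure Algorithm (K : ℕ) where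
  /-- the conditional law of the next arm given the history -/
  select : (t : ℕ) → Kernel (History K t) (Fin K)
  markov : ∀ t, IsMarkovKernel (select t)

/-- The law of the first `t` rounds when the algorithm `π` plays against arms whose rewards have
the laws `ρ k`: given the past, the next arm is drawn from `π.select`, and given the past and this
arm `k`, the reward is drawn from `ρ k`. -/
def historyLaw {K : ℕ} (π : Algorithm K) (ρ : Kernel (Fin K) ℝ) :
    (t : ℕ) → Measure (History K t)
  | 0 => Measure.dirac (fun i => i.elim0)
  | t + 1 =>
      (historyLaw π ρ t ⊗ₘ (π.select t ⊗ₖ ρ.prodMkLeft (History K t))).map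
        (fun p => (Fin.snoc p.1 p.2 : History K (t + 1)))

/- In what follows `ν θ k` is the law of the reward of arm `k` under the parameter `θ : Θ`. -/
variable {K : ℕ} {Θ : Type*} (ν : Θ → Kernel (Fin K) ℝ)

/-- The mean reward `μ_k(θ)` of arm `k` under the parameter `θ`. -/
def mean (k : Fin K) (θ : Θ) : ℝ := ∫ x, x ∂(ν θ k)

/-- The largest mean reward `max_ℓ μ_ℓ(θ)`. -/
def maxMean (θ : Θ) : ℝ := ⨆ k, mean ν k θ

/-- Arm `k` is optimal under `θ`: `μ_k(θ) = max_ℓ μ_ℓ(θ)`. -/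
def IsOptimal (θ : Θ) (k : Fin K) : Prop := mean ν k θ = maxMean ν θ

/-- The expected cumulative regret of `π` after `T` rounds under the parameter `θ`. -/
def regret (π : Algorithm K) (θ : Θ) (T : ℕ) : ℝ :=
  ∫ h, ∑ t : Fin T, (maxMean ν θ - mean ν (h t).1 θ) ∂(historyLaw π (ν θ) T)

/-- `π` is uniformly good: its regret is `o(T ^ a)` for all `a > 0` and all parameters. -/
def UniformlyGood (π : Algorithm K) : Prop :=
  ∀ θ : Θ, ∀ a : ℝ, 0 < a →
    (fun T : ℕ => regret ν π θ T) =o[atTop] (fun T : ℕ => (T : ℝ) ^ a)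

/-- Arm `k` is `S`-competitive: its mean reward is the highest among all arms for some `θ ∈ S`. -/
def IsCompetitive (S : Set Θ) (k : Fin K) : Prop := ∃ θ ∈ S, IsOptimal ν θ k

/-- The set `Θ* = {θ : μ_{k*}(θ) = μ_{k*}(θ*)}`. -/
def thetaStar (θstar : Θ) (kstar : Fin K) : Set Θ :=
  {θ | mean ν kstar θ = mean ν kstar θstar}

/-- The number `C̃(θ*)` of `Θ*`-competitive arms. -/
def numCompetitive (θstar : Θ) (kstar : Fin K) : ℕ :=
  {k : Fin K | IsCompetitive ν (thetaStar ν θstar kstar) k}.ncard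

/-- The set `Λ(θ*)` of the parameters in `Θ*` under which `k*` is not optimal. -/
def confusing (θstar : Θ) (kstar : Fin K) : Set Θ :=
  {lam ∈ thetaStar ν θstar kstar | ¬ IsOptimal ν lam kstar}

/-- Feasibility of the exploration rates `η`: `∑ k, η(k) D(θ*, λ, k) ≥ 1` for all `λ ∈ Λ(θ*)`,
where `D(θ*, λ, k)` is the Kullback-Leibler divergence between the reward laws of arm `k` under
`θ*` and under `λ`. -/
def IsFeasible (θstar : Θ) (kstar : Fin K) (η : Fin K → ℝ≥0) : Prop :=
  ∀ lam ∈ confusing ν θstar kstar, 1 ≤ ∑ k, (η k : ℝ≥0∞) * klDiv (ν θstar k) (ν lam k)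

/-- The constant `L(θ*)`: the value of the problem of minimizing
`∑ k, η(k) (max_ℓ μ_ℓ(θ*) - μ_k(θ*))` over the feasible rates `η ≥ 0`. -/
def lowerBoundConst (θstar : Θ) (kstar : Fin K) : ℝ≥0∞ :=
  ⨅ (η : Fin K → ℝ≥0) (_ : IsFeasible ν θstar kstar η),
    ∑ k, (η k : ℝ≥0∞) * ENNReal.ofReal (maxMean ν θstar - mean ν k θstar)

end StructuredBandit

end

/-! Change of measure on the event that `kstar` is played in more than half of the rounds. For a
uniformly good algorithm its probability tends to 1 under `θstar`, where `kstar` is the unique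
optimum, but is at most `T ^ (a - 1)` under a confusing `lam`, where `kstar` is suboptimal (Markov's
inequality in both cases). So the two history laws have divergence at least about `log T`, while
`klDiv_historyLaw_le` bounds it by the expected pulls weighted by the arms' divergences. The
expected pulls divided by `log T` are thus asymptotically feasible rates, and their cost is the
regret divided by `log T`.

Passing to the limit uses compactness of `ℝ≥0∞`, with two obstacles. The rate of `kstar` may become
infinite, which is harmless: its gap is zero, and its divergence vanishes on `Θ*` because its law is
determined by its mean. Constraints with an infinite divergence are lost in the limit; adding `ε` to
every rate restores them at a cost of order `ε`.

With one competitive arm there is no confusing parameter, so zero rates are feasible. Otherwise a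
single confusing parameter with finite divergences bounds the cost of all feasible rates away from
zero, which excludes bounded regret. -/

open scoped Topology

/-! ### Divergence: conditional laws, restriction, and events -/

namespace InformationTheory

variable {α β : Type*} {mα : MeasurableSpace α} {mβ : MeasurableSpace β}

/-- The conditional Kullback-Leibler divergence is the average of the divergences between the
conditional laws. -/
lemma klDiv_compProd_right_eq_lintegral [MeasurableSpace.CountableOrCountablyGenerated α β]
    (μ : Measure α) [IsFiniteMeasure μ] (κ η : Kernel α β) [IsFiniteKernel κ] [IsFiniteKernel η]
    (hκη : ∀ a, κ a ≪ η a) :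
    klDiv (μ ⊗ₘ κ) (μ ⊗ₘ η) = ∫⁻ a, klDiv (κ a) (η a) ∂μ := by
  have hmeas : Measurable (fun p : α × β => Kernel.rnDeriv κ η p.1 p.2) :=
    Kernel.measurable_rnDeriv κ η
  have hκ : η.withDensity (Kernel.rnDeriv κ η) = κ := by
    ext1 a
    exact Kernel.withDensity_rnDeriv_eq (hκη a)
  -- The kernel derivative is jointly measurable, so one function is both the density of the joint
  -- laws and, for each `a`, a version of the density of `κ a`.
  have hdens : μ ⊗ₘ κ = (μ ⊗ₘ η).withDensity (fun p => Kernel.rnDeriv κ η p.1 p.2) := by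
    have : IsSFiniteKernel (η.withDensity (Kernel.rnDeriv κ η)) := by rw [hκ]; infer_instance
    conv_lhs => rw [← hκ]
    rw [Measure.compProd_withDensity hmeas]
  have hrn : (μ ⊗ₘ κ).rnDeriv (μ ⊗ₘ η) =ᵐ[μ ⊗ₘ η] fun p => Kernel.rnDeriv κ η p.1 p.2 := by
    rw [hdens]
    exact Measure.rnDeriv_withDensity _ hmeas
  rw [klDiv_eq_lintegral_klFun_of_ac (Measure.AbsolutelyContinuous.compProd_right
    (ae_of_all _ hκη))]
  rw [lintegral_congr_ae (g := fun p =>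
    ENNReal.ofReal (klFun (Kernel.rnDeriv κ η p.1 p.2).toReal))]
  · rw [Measure.lintegral_compProd (by fun_prop)]
    refine lintegral_congr fun a => ?_
    rw [klDiv_eq_lintegral_klFun_of_ac (hκη a)]
    refine lintegral_congr_ae ?_
    filter_upwards [Kernel.rnDeriv_eq_rnDeriv_measure (κ := κ) (η := η) (a := a)] with x hx
    rw [hx]
  · filter_upwards [hrn] with p hp
    rw [hp]

/-- Restriction keeps the density, and the divergence integrates the nonnegative function `klFun` of
it. Applied to an event, this isolates the contribution of that event alone. -/
lemma klDiv_restrict_le (μ ν : Measure α) [IsFiniteMeasure μ] [IsFiniteMeasure ν] {s : Set α}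
    (hs : MeasurableSet s) : klDiv (μ.restrict s) (ν.restrict s) ≤ klDiv μ ν := by
  by_cases h : μ ≪ ν
  swap; · simp [klDiv_of_not_ac h]
  rw [klDiv_eq_lintegral_klFun_of_ac h, klDiv_eq_lintegral_klFun_of_ac (h.restrict s)]
  have hd : μ.restrict s = (ν.restrict s).withDensity (μ.rnDeriv ν) := by
    rw [← restrict_withDensity hs, Measure.withDensity_rnDeriv_eq _ _ h]
  have hrn : (μ.restrict s).rnDeriv (ν.restrict s) =ᵐ[ν.restrict s] μ.rnDeriv ν := by
    conv_lhs => rw [hd]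
    exact Measure.rnDeriv_withDensity _ (Measure.measurable_rnDeriv _ _)
  rw [lintegral_congr_ae (g := fun x => ENNReal.ofReal (klFun (μ.rnDeriv ν x).toReal))]
  · exact setLIntegral_le_lintegral _ _
  · filter_upwards [hrn] with x hx
    rw [hx]

/-- If an event is likely under `μ` and unlikely under `ν`, then the divergence is large. -/
lemma ofReal_measureReal_mul_neg_log_sub_one_le_klDiv (μ ν : Measure α) [IsProbabilityMeasure μ]
    [IsFiniteMeasure ν] {s : Set α} (hs : MeasurableSet s) {ε : ℝ} (hν : ν.real s ≤ ε) :
    ENNReal.ofReal (μ.real s * (-Real.log ε) - 1) ≤ klDiv μ ν := by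
  by_cases h : μ ≪ ν
  swap; · simp [klDiv_of_not_ac h]
  refine le_trans ?_ (klDiv_restrict_le μ ν hs)
  refine le_trans (ENNReal.ofReal_le_ofReal ?_)
    (mul_log_le_klDiv (μ.restrict s) (ν.restrict s))
  simp only [measureReal_restrict_apply_univ]
  have hp1 : μ.real s ≤ 1 := measureReal_le_one
  have hq0 : 0 ≤ ν.real s := measureReal_nonneg
  rcases (measureReal_nonneg (μ := μ) (s := s)).eq_or_lt with hp | hp
  · rw [← hp]
    simp only [zero_mul, zero_sub, zero_add, sub_zero]
    linarith
  have hq : 0 < ν.real s := by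
    refine hq0.lt_of_ne fun h0 => hp.ne' ?_
    have : ν s = 0 := by simpa [measureReal_def, ENNReal.toReal_eq_zero_iff] using h0.symm
    simp [measureReal_def, h this]
  rw [Real.log_div hp.ne' hq.ne']
  have h1 : Real.log (ν.real s) ≤ Real.log ε := Real.log_le_log hq hν
  -- With `p = μ.real s` and `q = ν.real s`, the bound `p log p ≥ p - 1` absorbs the mass correction
  -- `q - p` and leaves the constant `-1`.
  have h2 : μ.real s - 1 ≤ μ.real s * Real.log (μ.real s) := by
    have := Real.one_sub_inv_le_log_of_pos hp
    calc μ.real s - 1 = μ.real s * (1 - (μ.real s)⁻¹) := by field_simp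
      _ ≤ _ := by gcongr
  nlinarith [mul_le_mul_of_nonneg_left h1 hp.le]

end InformationTheory

/-! ### Pull counts, regret and the divergence decomposition -/

namespace StructuredBandit

variable {K : ℕ}

instance (π : Algorithm K) (t : ℕ) : IsMarkovKernel (π.select t) := π.markov t

lemma measurable_snoc (t : ℕ) :
    Measurable (fun p : History K t × (Fin K × ℝ) => (Fin.snoc p.1 p.2 : History K (t + 1))) := by
  refine measurable_pi_lambda _ fun i => ?_
  refine Fin.lastCases ?_ (fun j => ?_) i
  · simpa using measurable_snd
  · simp only [Fin.snoc_castSucc]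
    exact (measurable_pi_apply j).comp measurable_fst

instance isProbabilityMeasure_historyLaw (π : Algorithm K) (ρ : Kernel (Fin K) ℝ)
    [IsMarkovKernel ρ] : ∀ t, IsProbabilityMeasure (historyLaw π ρ t)
  | 0 => by unfold historyLaw; infer_instance
  | t + 1 => by
      have := isProbabilityMeasure_historyLaw π ρ t
      unfold historyLaw
      exact Measure.isProbabilityMeasure_map (measurable_snoc t).aemeasurable

/-- The number of pulls of arm `k` in a history. -/
def pulls {t : ℕ} (k : Fin K) (h : History K t) : ℕ := ∑ i, if (h i).1 = k then 1 else 0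

@[fun_prop]
lemma measurable_pulls {t : ℕ} (k : Fin K) : Measurable (pulls (t := t) k) := by
  refine Finset.measurable_sum _ fun i _ => ?_
  refine Measurable.ite ?_ measurable_const measurable_const
  exact ((measurable_pi_apply i).fst) (measurableSet_singleton k)

@[fun_prop]
lemma measurable_pulls_ennreal {t : ℕ} (k : Fin K) :
    Measurable fun h : History K t => (pulls k h : ℝ≥0∞) :=
  measurable_from_top.comp (measurable_pulls k)

@[fun_prop]
lemma measurable_pulls_real {t : ℕ} (k : Fin K) :
    Measurable fun h : History K t => (pulls k h : ℝ) :=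
  measurable_from_top.comp (measurable_pulls k)

lemma pulls_snoc {t : ℕ} (k : Fin K) (h : History K t) (x : Fin K × ℝ) :
    pulls k (Fin.snoc h x : History K (t + 1)) = pulls k h + if x.1 = k then 1 else 0 := by
  simp only [pulls, Fin.sum_univ_castSucc, Fin.snoc_castSucc, Fin.snoc_last]

lemma sum_apply_arm {t : ℕ} (f : Fin K → ℝ) (h : History K t) :
    ∑ i, f (h i).1 = ∑ k, f k * pulls k h := by
  simp only [pulls, Nat.cast_sum, Finset.mul_sum, Nat.cast_ite, Nat.cast_one, Nat.cast_zero]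
  rw [Finset.sum_comm]
  simp

lemma sum_pulls {t : ℕ} (h : History K t) : ∑ k, pulls k h = t := by
  simp only [pulls]
  rw [Finset.sum_comm]
  simp

lemma pulls_le {t : ℕ} (k : Fin K) (h : History K t) : pulls k h ≤ t :=
  (Finset.single_le_sum (f := fun k => pulls k h) (fun _ _ => Nat.zero_le _)
    (Finset.mem_univ k)).trans_eq (sum_pulls h)

/-- The expected number of pulls of arm `k` in the first `t` rounds. -/
noncomputable def meanPulls (π : Algorithm K) (ρ : Kernel (Fin K) ℝ) (k : Fin K) (t : ℕ) : ℝ≥0∞ :=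
  ∫⁻ h, (pulls k h : ℝ≥0∞) ∂(historyLaw π ρ t)

lemma integral_pulls (π : Algorithm K) (ρ : Kernel (Fin K) ℝ) (k : Fin K) (t : ℕ) :
    ∫ h, (pulls k h : ℝ) ∂(historyLaw π ρ t) = (meanPulls π ρ k t).toReal := by
  rw [integral_eq_lintegral_of_nonneg_ae (ae_of_all _ fun h => by positivity)
    (measurable_pulls_real k).aestronglyMeasurable]
  simp [meanPulls]

variable (π : Algorithm K) (ρ ρ' : Kernel (Fin K) ℝ) [IsMarkovKernel ρ] [IsMarkovKernel ρ']

lemma meanPulls_succ (k : Fin K) (t : ℕ) :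
    meanPulls π ρ k (t + 1)
      = meanPulls π ρ k t + ∫⁻ h, π.select t h {k} ∂(historyLaw π ρ t) := by
  have hind : Measurable fun p : Fin K × ℝ => if p.1 = k then (1 : ℝ≥0∞) else 0 :=
    Measurable.ite (measurable_fst (measurableSet_singleton k)) measurable_const measurable_const
  have hind' : Measurable fun p : History K t × Fin K × ℝ =>
      if p.2.1 = k then (1 : ℝ≥0∞) else 0 := hind.comp measurable_snd
  simp only [meanPulls, historyLaw]
  rw [lintegral_map (measurable_pulls_ennreal k) (measurable_snoc t)]
  simp only [pulls_snoc, Nat.cast_add, Nat.cast_ite, Nat.cast_one, Nat.cast_zero]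
  rw [Measure.lintegral_compProd (by fun_prop), ← lintegral_add_left (measurable_pulls_ennreal k)]
  refine lintegral_congr fun h => ?_
  dsimp only
  rw [lintegral_add_left measurable_const, lintegral_const, measure_univ, mul_one,
    Kernel.lintegral_compProd _ _ _ hind]
  congr 1
  rw [← lintegral_indicator_one (measurableSet_singleton k)]
  refine lintegral_congr fun j => ?_
  by_cases hj : j = k <;> simp [hj]

lemma meanPulls_le (k : Fin K) (t : ℕ) : meanPulls π ρ k t ≤ t := by
  calc meanPulls π ρ k t ≤ ∫⁻ _, (t : ℝ≥0∞) ∂(historyLaw π ρ t) :=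
        lintegral_mono fun h => Nat.cast_le.2 (pulls_le k h)
    _ = t := by simp

lemma meanPulls_ne_top (k : Fin K) (t : ℕ) : meanPulls π ρ k t ≠ ∞ :=
  ((meanPulls_le π ρ k t).trans_lt (ENNReal.natCast_lt_top t)).ne

lemma integrable_pulls (k : Fin K) (t : ℕ) :
    Integrable (fun h => (pulls k h : ℝ)) (historyLaw π ρ t) := by
  refine Integrable.of_bound
    (measurable_pulls_real k).aestronglyMeasurable (t : ℝ)
    (ae_of_all _ fun h => ?_)
  simpa using pulls_le k h

lemma regret_eq_sum {Θ : Type*} (ν : Θ → Kernel (Fin K) ℝ) [∀ θ, IsMarkovKernel (ν θ)]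
    (θ : Θ) (T : ℕ) :
    regret ν π θ T
      = ∑ k, (maxMean ν θ - mean ν k θ) * (meanPulls π (ν θ) k T).toReal := by
  simp only [regret]
  simp_rw [sum_apply_arm (fun k => maxMean ν θ - mean ν k θ)]
  rw [integral_finsetSum _ fun k _ => (integrable_pulls π (ν θ) k T).const_mul _]
  simp_rw [integral_const_mul, integral_pulls]

/-- **Divergence decomposition**: the divergence between the laws of the history is at most the
sum of the divergences of the arms weighted by the expected numbers of pulls. -/
lemma klDiv_historyLaw_le (hac : ∀ k, ρ k ≪ ρ' k) (t : ℕ) :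
    klDiv (historyLaw π ρ t) (historyLaw π ρ' t)
      ≤ ∑ k, meanPulls π ρ k t * klDiv (ρ k) (ρ' k) := by
  induction t with
  | zero => simp [historyLaw]
  | succ t ih =>
    have hstep : ∀ h, klDiv ((π.select t ⊗ₖ ρ.prodMkLeft (History K t)) h)
        ((π.select t ⊗ₖ ρ'.prodMkLeft (History K t)) h)
          = ∑ k, π.select t h {k} * klDiv (ρ k) (ρ' k) := by
      intro h
      -- Both laws share the arm selection, so only the reward kernels contribute.
      simp only [Kernel.compProd_apply_eq_compProd_sectR, Kernel.sectR_prodMkLeft]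
      rw [klDiv_compProd_right_eq_lintegral _ _ _ hac, lintegral_fintype]
      simp_rw [mul_comm]
    have hac' : ∀ h, (π.select t ⊗ₖ ρ.prodMkLeft (History K t)) h
        ≪ (π.select t ⊗ₖ ρ'.prodMkLeft (History K t)) h := by
      intro h
      simp only [Kernel.compProd_apply_eq_compProd_sectR, Kernel.sectR_prodMkLeft]
      exact Measure.AbsolutelyContinuous.compProd_right (ae_of_all _ hac)
    have hmeas : ∀ k, Measurable fun h => π.select t h {k} := fun k =>
      Kernel.measurable_coe _ (measurableSet_singleton k)
    simp only [historyLaw]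
    -- Data processing removes the relabelling by `Fin.snoc`; the chain rule then splits off the
    -- last round.
    refine (klDiv_map_le _ _ (measurable_snoc t)).trans ?_
    rw [klDiv_compProd_eq_add, klDiv_compProd_right_eq_lintegral _ _ _ hac']
    simp_rw [hstep, meanPulls_succ, add_mul]
    rw [Finset.sum_add_distrib, lintegral_finsetSum _ fun k _ => (hmeas k).mul_const _]
    simp_rw [lintegral_mul_const _ (hmeas _)]
    gcongr

end StructuredBandit

/-! ### Playing one arm for more than half of the time -/

namespace StructuredBandit

variable {K : ℕ} {Θ : Type*} (π : Algorithm K)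

section Markov

variable (ρ : Kernel (Fin K) ℝ) [IsMarkovKernel ρ]

lemma measureReal_lt_two_mul_pulls (k : Fin K) (T : ℕ) :
    (historyLaw π ρ T).real {h | T < 2 * pulls k h} * T ≤ 2 * (meanPulls π ρ k T).toReal := by
  have h := mul_meas_ge_le_integral_of_nonneg (μ := historyLaw π ρ T)
    (f := fun h => 2 * (pulls k h : ℝ)) (ae_of_all _ fun h => by positivity)
    ((integrable_pulls π ρ k T).const_mul 2) (T : ℝ)
  rw [integral_const_mul, integral_pulls] at h
  refine le_trans ?_ h
  rw [mul_comm]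
  refine mul_le_mul_of_nonneg_left (measureReal_mono ?_) (Nat.cast_nonneg T)
  rintro x (hx : T < 2 * pulls k x)
  show (T : ℝ) ≤ 2 * pulls k x
  exact_mod_cast hx.le

lemma measureReal_two_mul_pulls_le (k : Fin K) (T : ℕ) :
    (historyLaw π ρ T).real {h | 2 * pulls k h ≤ T} * T
      ≤ 2 * ∑ j ∈ Finset.univ.erase k, (meanPulls π ρ j T).toReal := by
  have hint : Integrable (fun h => ∑ j ∈ Finset.univ.erase k, (pulls j h : ℝ))
      (historyLaw π ρ T) := integrable_finsetSum _ fun j _ => integrable_pulls π ρ j T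
  have h := mul_meas_ge_le_integral_of_nonneg (μ := historyLaw π ρ T)
    (f := fun h => 2 * ∑ j ∈ Finset.univ.erase k, (pulls j h : ℝ))
    (ae_of_all _ fun h => by positivity) (hint.const_mul 2) (T : ℝ)
  rw [integral_const_mul, integral_finsetSum _ fun j _ => integrable_pulls π ρ j T] at h
  simp_rw [integral_pulls] at h
  refine le_trans ?_ h
  rw [mul_comm]
  refine mul_le_mul_of_nonneg_left (measureReal_mono ?_) (Nat.cast_nonneg T)
  rintro x (hx : 2 * pulls k x ≤ T)
  show (T : ℝ) ≤ 2 * ∑ j ∈ Finset.univ.erase k, (pulls j x : ℝ)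
  have hsum : pulls k x + ∑ j ∈ Finset.univ.erase k, pulls j x = T :=
    (Finset.add_sum_erase _ (fun j => pulls j x) (Finset.mem_univ k)).trans (sum_pulls x)
  have : T ≤ 2 * ∑ j ∈ Finset.univ.erase k, pulls j x := by omega
  exact_mod_cast this

end Markov

variable (ν : Θ → Kernel (Fin K) ℝ)

lemma mean_le_maxMean (θ : Θ) (k : Fin K) : mean ν k θ ≤ maxMean ν θ :=
  le_ciSup (f := fun k => mean ν k θ) (Set.finite_range _).bddAbove k

lemma exists_isOptimal (θ : Θ) (k : Fin K) : ∃ j, IsOptimal ν θ j := by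
  have : Nonempty (Fin K) := ⟨k⟩
  obtain ⟨j, hj⟩ := exists_eq_ciSup_of_finite (f := fun k => mean ν k θ)
  exact ⟨j, hj⟩

lemma IsOptimal.of_forall_lt {θ : Θ} {k : Fin K}
    (h : ∀ j, j ≠ k → mean ν j θ < mean ν k θ) : IsOptimal ν θ k := by
  obtain ⟨j, hj⟩ := exists_isOptimal ν θ k
  by_cases hjk : j = k
  · exact hjk ▸ hj
  · have h1 : mean ν j θ = maxMean ν θ := hj
    exact absurd (h j hjk) (h1 ▸ mean_le_maxMean ν θ k).not_gt

variable [∀ θ, IsMarkovKernel (ν θ)]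

lemma gap_mul_meanPulls_le_regret (θ : Θ) (k : Fin K) (T : ℕ) :
    (maxMean ν θ - mean ν k θ) * (meanPulls π (ν θ) k T).toReal ≤ regret ν π θ T := by
  rw [regret_eq_sum]
  exact Finset.single_le_sum (f := fun k =>
      (maxMean ν θ - mean ν k θ) * (meanPulls π (ν θ) k T).toReal)
    (fun j _ => mul_nonneg (sub_nonneg.2 (mean_le_maxMean ν θ j)) ENNReal.toReal_nonneg)
    (Finset.mem_univ k)

lemma ofReal_regret (θ : Θ) (T : ℕ) :
    ENNReal.ofReal (regret ν π θ T)
      = ∑ k, meanPulls π (ν θ) k T * ENNReal.ofReal (maxMean ν θ - mean ν k θ) := by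
  have h0 : ∀ k, 0 ≤ maxMean ν θ - mean ν k θ := fun k => sub_nonneg.2 (mean_le_maxMean ν θ k)
  rw [regret_eq_sum, ENNReal.ofReal_sum_of_nonneg
    fun k _ => mul_nonneg (h0 k) ENNReal.toReal_nonneg]
  refine Finset.sum_congr rfl fun k _ => ?_
  rw [ENNReal.ofReal_mul (h0 k), ENNReal.ofReal_toReal (meanPulls_ne_top _ _ _ _), mul_comm]

variable {π ν}

/-- Under a suboptimal arm's parameter, a uniformly good algorithm rarely plays this arm for more
than half of the time. -/
lemma UniformlyGood.eventually_measureReal_le_rpow (hπ : UniformlyGood ν π) {lam : Θ}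
    {k : Fin K} (hk : ¬ IsOptimal ν lam k) {a : ℝ} (ha : 0 < a) :
    ∀ᶠ T : ℕ in atTop,
      (historyLaw π (ν lam) T).real {h | T < 2 * pulls k h} ≤ (T : ℝ) ^ (a - 1) := by
  have hgap : 0 < maxMean ν lam - mean ν k lam :=
    sub_pos.2 ((mean_le_maxMean ν lam k).lt_of_ne hk)
  -- Half the gap is the constant that cancels both the factor 2 from Markov's inequality and the
  -- gap in the regret.
  filter_upwards [(hπ lam a ha).def (half_pos hgap), eventually_gt_atTop 0] with T hT hT0
  have hT0' : (0 : ℝ) < T := by exact_mod_cast hT0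
  have h1 := measureReal_lt_two_mul_pulls π (ν lam) k T
  have h2 := gap_mul_meanPulls_le_regret π ν lam k T
  rw [Real.norm_of_nonneg (Real.rpow_nonneg hT0'.le a)] at hT
  have h3 := (le_abs_self _).trans hT
  rw [Real.rpow_sub_one hT0'.ne', le_div_iff₀ hT0']
  refine h1.trans ?_
  refine le_of_mul_le_mul_left ?_ hgap
  linarith

/-- A uniformly good algorithm most likely plays the unique optimal arm for more than half of the
time. -/
lemma UniformlyGood.eventually_le_measureReal (hπ : UniformlyGood ν π) {θ : Θ}
    {k : Fin K} (hk : ∀ j, j ≠ k → mean ν j θ < maxMean ν θ) {a : ℝ} (ha : 0 < a) :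
    ∀ᶠ T : ℕ in atTop,
      1 - a ≤ (historyLaw π (ν θ) T).real {h | T < 2 * pulls k h} := by
  set C : ℝ := ∑ j ∈ Finset.univ.erase k, (maxMean ν θ - mean ν j θ)⁻¹ with hC
  have hC0 : 0 ≤ C :=
    Finset.sum_nonneg fun j _ => inv_nonneg.2 (sub_nonneg.2 (mean_le_maxMean ν θ j))
  -- Pulls of the other arms total at most `C` times the regret, and Markov's inequality doubles
  -- this. The `+ 1` keeps the denominator positive when `C = 0`.
  have hc : 0 < a / (2 * C + 1) := by positivity
  filter_upwards [(hπ θ 1 one_pos).def hc, eventually_gt_atTop 0] with T hT hT0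
  have hT0' : (0 : ℝ) < T := by exact_mod_cast hT0
  have hR : regret ν π θ T ≤ a / (2 * C + 1) * T := by
    simpa using (le_abs_self _).trans hT
  have h1 := measureReal_two_mul_pulls_le π (ν θ) k T
  have h2 : ∑ j ∈ Finset.univ.erase k, (meanPulls π (ν θ) j T).toReal
      ≤ C * regret ν π θ T := by
    rw [hC, Finset.sum_mul]
    refine Finset.sum_le_sum fun j hj => ?_
    have hgap : 0 < maxMean ν θ - mean ν j θ := sub_pos.2 (hk j (Finset.ne_of_mem_erase hj))
    rw [le_inv_mul_iff₀ hgap]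
    exact gap_mul_meanPulls_le_regret π ν θ j T
  have h3 : C * regret ν π θ T ≤ C * (a / (2 * C + 1) * T) := by gcongr
  have h4 : 2 * (C * (a / (2 * C + 1) * T)) ≤ a * T := by
    rw [show 2 * (C * (a / (2 * C + 1) * T)) = (2 * C / (2 * C + 1)) * (a * T) by ring]
    refine mul_le_of_le_one_left (by positivity) ?_
    rw [div_le_one (by positivity)]
    linarith
  have h5 : (historyLaw π (ν θ) T).real {h | 2 * pulls k h ≤ T} ≤ a :=
    le_of_mul_le_mul_right (by linarith) hT0'
  have hmeas : MeasurableSet {h : History K T | T < 2 * pulls k h} :=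
    measurableSet_lt measurable_const ((measurable_pulls k).const_mul 2)
  have h6 : {h : History K T | 2 * pulls k h ≤ T} = {h | T < 2 * pulls k h}ᶜ := by
    ext h; simp
  rw [h6, probReal_compl_eq_one_sub hmeas] at h5
  linarith

/-- One factor `1 - a` is the probability of the event under `θ`, the other comes from the exponent
of its probability under `lam`. -/
lemma UniformlyGood.eventually_le_sum_meanPulls_mul_klDiv (hπ : UniformlyGood ν π) {θ lam : Θ}
    {k : Fin K} (hk : ∀ j, j ≠ k → mean ν j θ < maxMean ν θ) (hlam : ¬ IsOptimal ν lam k)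
    (hac : ∀ j, ν θ j ≪ ν lam j) {a : ℝ} (ha : 0 < a) (ha1 : a < 1) :
    ∀ᶠ T : ℕ in atTop, ENNReal.ofReal ((1 - a) ^ 2 * Real.log T - 1)
      ≤ ∑ j, meanPulls π (ν θ) j T * klDiv (ν θ j) (ν lam j) := by
  filter_upwards [hπ.eventually_measureReal_le_rpow hlam ha, hπ.eventually_le_measureReal hk ha,
    eventually_gt_atTop 0] with T h1 h2 hT0
  have hT0' : (0 : ℝ) < T := by exact_mod_cast hT0
  have hmeas : MeasurableSet {h : History K T | T < 2 * pulls k h} :=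
    measurableSet_lt measurable_const ((measurable_pulls k).const_mul 2)
  refine le_trans (ENNReal.ofReal_le_ofReal ?_)
    ((ofReal_measureReal_mul_neg_log_sub_one_le_klDiv _ _ hmeas h1).trans
      (klDiv_historyLaw_le π (ν θ) (ν lam) hac T))
  rw [Real.log_rpow hT0']
  have hlog : 0 ≤ (1 - a) * Real.log T :=
    mul_nonneg (by linarith) (Real.log_natCast_nonneg T)
  nlinarith [mul_le_mul_of_nonneg_right h2 hlog]

end StructuredBandit

/-! ### The lower bound by compactness -/

namespace StructuredBandit

variable {K : ℕ} {Θ : Type*} {ν : Θ → Kernel (Fin K) ℝ} [∀ θ, IsMarkovKernel (ν θ)]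
  {π : Algorithm K} {θstar : Θ} {kstar : Fin K}

/-- An ultrafilter concentrated on the horizons with small regret replaces a subsequence: as `ℝ≥0∞`
is compact, all normalized pull counts converge along it at once. -/
lemma exists_ultrafilter_tendsto_meanPulls_div_log {b : ℝ≥0∞}
    (hb : liminf (fun T : ℕ => ENNReal.ofReal (regret ν π θstar T / Real.log T)) atTop < b) :
    ∃ (F : Ultrafilter ℕ) (η : Fin K → ℝ≥0∞), (F : Filter ℕ) ≤ atTop ∧
      (∀ k, Tendsto (fun T : ℕ => meanPulls π (ν θstar) k T / ENNReal.ofReal (Real.log T)) F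
        (𝓝 (η k))) ∧
      ∑ k, η k * ENNReal.ofReal (maxMean ν θstar - mean ν k θstar) ≤ b := by
  have hfreq := frequently_lt_of_liminf_lt (by isBoundedDefault) hb
  have : (atTop ⊓ 𝓟 {T : ℕ | ENNReal.ofReal (regret ν π θstar T / Real.log T) < b}).NeBot :=
    inf_principal_neBot_iff.2 fun U hU => (hfreq.and_eventually hU).exists.imp fun _ h => h.symm
  obtain ⟨F, hF⟩ := Ultrafilter.exists_le
    (atTop ⊓ 𝓟 {T : ℕ | ENNReal.ofReal (regret ν π θstar T / Real.log T) < b})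
  have hFtop : (F : Filter ℕ) ≤ atTop := hF.trans inf_le_left
  have hFb : ∀ᶠ T in (F : Filter ℕ), ENNReal.ofReal (regret ν π θstar T / Real.log T) < b :=
    (hF.trans inf_le_right) (mem_principal_self _)
  have hlim : ∀ k, ∃ y, Tendsto
      (fun T : ℕ => meanPulls π (ν θstar) k T / ENNReal.ofReal (Real.log T)) F (𝓝 y) :=
    fun k => ⟨_, (F.map
      (fun T : ℕ => meanPulls π (ν θstar) k T / ENNReal.ofReal (Real.log T))).le_nhds_lim⟩
  choose η hη using hlim
  refine ⟨F, η, hFtop, hη, ?_⟩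
  refine le_of_tendsto (tendsto_finsetSum _ fun k _ =>
    ENNReal.Tendsto.mul_const (hη k) (Or.inr ENNReal.ofReal_ne_top)) ?_
  filter_upwards [hFb, hFtop (eventually_gt_atTop 1)] with T hT hT1
  have hlog : 0 < Real.log T := Real.log_pos (by exact_mod_cast hT1)
  refine le_trans (le_of_eq ?_) hT.le
  rw [ENNReal.ofReal_div_of_pos hlog, ofReal_regret, div_eq_mul_inv, Finset.sum_mul]
  refine Finset.sum_congr rfl fun k _ => ?_
  rw [div_eq_mul_inv, mul_right_comm]

/-- Limits of the normalized numbers of pulls satisfy the constraint of every confusing parameter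
at a finite divergence. -/
lemma UniformlyGood.one_le_sum_mul_klDiv (hπ : UniformlyGood ν π) {lam : Θ}
    (hk : ∀ j, j ≠ kstar → mean ν j θstar < maxMean ν θstar) (hlam : ¬ IsOptimal ν lam kstar)
    (hfin : ∀ j, klDiv (ν θstar j) (ν lam j) ≠ ∞) {F : Filter ℕ} [F.NeBot] (hF : F ≤ atTop)
    {η : Fin K → ℝ≥0∞}
    (hη : ∀ k, Tendsto (fun T : ℕ => meanPulls π (ν θstar) k T / ENNReal.ofReal (Real.log T)) F
        (𝓝 (η k))) :
    1 ≤ ∑ k, η k * klDiv (ν θstar k) (ν lam k) := by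
  have hbound : ∀ a : ℝ, 0 < a → a < 1 →
      ENNReal.ofReal ((1 - a) ^ 2) ≤ ∑ k, η k * klDiv (ν θstar k) (ν lam k) := by
    intro a ha ha1
    have hlogtop : Tendsto (fun T : ℕ => Real.log T) F atTop :=
      (Real.tendsto_log_atTop.comp tendsto_natCast_atTop_atTop).mono_left hF
    have hleft : Tendsto (fun T : ℕ => ENNReal.ofReal ((1 - a) ^ 2 - (Real.log T)⁻¹)) F
        (𝓝 (ENNReal.ofReal ((1 - a) ^ 2))) := by
      refine ENNReal.tendsto_ofReal ?_
      simpa using tendsto_const_nhds.sub (tendsto_inv_atTop_zero.comp hlogtop)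
    -- Finite divergences are needed here: multiplication by `∞` is not continuous at `0`.
    refine le_of_tendsto_of_tendsto hleft (tendsto_finsetSum _ fun k _ =>
      ENNReal.Tendsto.mul_const (hη k) (Or.inr (hfin k))) ?_
    filter_upwards [hF (hπ.eventually_le_sum_meanPulls_mul_klDiv hk hlam
      (fun j => (klDiv_ne_top_iff.1 (hfin j)).1) ha ha1), hF (eventually_gt_atTop 1)]
      with T hT hT1
    have hlog : 0 < Real.log T := Real.log_pos (by exact_mod_cast hT1)
    calc ENNReal.ofReal ((1 - a) ^ 2 - (Real.log T)⁻¹)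
        = ENNReal.ofReal ((1 - a) ^ 2 * Real.log T - 1) / ENNReal.ofReal (Real.log T) := by
          rw [← ENNReal.ofReal_div_of_pos hlog]
          congr 1
          field_simp
      _ ≤ (∑ k, meanPulls π (ν θstar) k T * klDiv (ν θstar k) (ν lam k))
            / ENNReal.ofReal (Real.log T) := by gcongr
      _ = _ := by
          rw [div_eq_mul_inv, Finset.sum_mul]
          refine Finset.sum_congr rfl fun k _ => ?_
          rw [div_eq_mul_inv, mul_right_comm]
  have hlim : Tendsto (fun a : ℝ => ENNReal.ofReal ((1 - a) ^ 2)) (𝓝[>] 0) (𝓝 1) := by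
    have : Tendsto (fun a : ℝ => ENNReal.ofReal ((1 - a) ^ 2)) (𝓝 0)
        (𝓝 (ENNReal.ofReal ((1 - 0) ^ 2))) :=
      (ENNReal.continuous_ofReal.comp (by fun_prop)).tendsto 0
    simpa using this.mono_left nhdsWithin_le_nhds
  refine le_of_tendsto hlim ?_
  filter_upwards [self_mem_nhdsWithin, nhdsWithin_le_nhds (Iio_mem_nhds one_pos)] with a ha ha1
  exact hbound a ha ha1

/-- **Graves-Lai lower bound** for uniformly good algorithms. -/
theorem UniformlyGood.lowerBoundConst_le_liminf (hπ : UniformlyGood ν π)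
    (hparam : ∀ θ lam, mean ν kstar θ = mean ν kstar lam → ν θ kstar = ν lam kstar)
    (hopt : ∀ k, k ≠ kstar → mean ν k θstar < mean ν kstar θstar) :
    lowerBoundConst ν θstar kstar ≤
      liminf (fun T : ℕ => ENNReal.ofReal (regret ν π θstar T / Real.log T)) atTop := by
  have hstar : mean ν kstar θstar = maxMean ν θstar := IsOptimal.of_forall_lt ν hopt
  refine le_of_forall_gt fun b hb => ?_
  -- The intermediate `b'` is finite, which forces finite limit rates on all arms with a positive
  -- gap.
  obtain ⟨b', hb', hbb'⟩ := exists_between hb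
  obtain ⟨F, η, hF, hη, hcost⟩ := exists_ultrafilter_tendsto_meanPulls_div_log hb'
  refine lt_of_le_of_lt ?_ hbb'
  have hb'top : b' ≠ ∞ := hbb'.ne_top
  have hgap : ∀ k, k ≠ kstar → ENNReal.ofReal (maxMean ν θstar - mean ν k θstar) ≠ 0 :=
    fun k hk => by simpa [← hstar] using hopt k hk
  have hηtop : ∀ k, k ≠ kstar → η k ≠ ∞ := by
    intro k hk htop
    have h1 : η k * ENNReal.ofReal (maxMean ν θstar - mean ν k θstar) ≤ b' :=
      (Finset.single_le_sum (f := fun k =>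
        η k * ENNReal.ofReal (maxMean ν θstar - mean ν k θstar)) (fun _ _ => zero_le)
        (Finset.mem_univ k)).trans hcost
    rw [htop, ENNReal.top_mul (hgap k hk), top_le_iff] at h1
    exact hb'top h1
  have key : ∀ ε : ℝ≥0, 0 < ε → lowerBoundConst ν θstar kstar
      ≤ b' + ε * ∑ k, ENNReal.ofReal (maxMean ν θstar - mean ν k θstar) := by
    intro ε hε
    have hcoe : ∀ k, k ≠ kstar → (((η k).toNNReal + ε : ℝ≥0) : ℝ≥0∞) = η k + ε := by
      intro k hk
      rw [ENNReal.coe_add, ENNReal.coe_toNNReal (hηtop k hk)]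
    refine (iInf₂_le (fun k => (η k).toNNReal + ε) ?_).trans ?_
    · intro lam hlam
      by_cases hfin : ∀ j, klDiv (ν θstar j) (ν lam j) ≠ ∞
      · refine (hπ.one_le_sum_mul_klDiv (fun j hj => hstar ▸ hopt j hj) hlam.2 hfin hF hη).trans
          (Finset.sum_le_sum fun k _ => ?_)
        by_cases hk : k = kstar
        · subst hk
          -- `η kstar` may be `∞`, where `toNNReal` gives 0; the zero divergence makes this value
          -- irrelevant.
          simp [hparam θstar lam hlam.1.symm]
        · rw [hcoe k hk]
          gcongr
          exact le_self_add
      · push Not at hfin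
        obtain ⟨j, hj⟩ := hfin
        refine le_trans ?_ (Finset.single_le_sum (f := fun k =>
          (((η k).toNNReal + ε : ℝ≥0) : ℝ≥0∞) * klDiv (ν θstar k) (ν lam k))
          (fun _ _ => zero_le) (Finset.mem_univ j))
        rw [hj, ENNReal.mul_top (by simp [hε.ne'])]
        exact le_top
    · calc ∑ k, (((η k).toNNReal + ε : ℝ≥0) : ℝ≥0∞)
              * ENNReal.ofReal (maxMean ν θstar - mean ν k θstar)
          ≤ ∑ k, (η k + ε) * ENNReal.ofReal (maxMean ν θstar - mean ν k θstar) := by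
            refine Finset.sum_le_sum fun k _ => ?_
            by_cases hk : k = kstar
            · simp [hk, hstar]
            · rw [hcoe k hk]
        _ = ∑ k, η k * ENNReal.ofReal (maxMean ν θstar - mean ν k θstar)
              + ε * ∑ k, ENNReal.ofReal (maxMean ν θstar - mean ν k θstar) := by
            simp_rw [add_mul]
            rw [Finset.sum_add_distrib, Finset.mul_sum]
        _ ≤ b' + ε * ∑ k, ENNReal.ofReal (maxMean ν θstar - mean ν k θstar) := by gcongr
  have hS : ∑ k, ENNReal.ofReal (maxMean ν θstar - mean ν k θstar) ≠ ∞ :=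
    ENNReal.sum_ne_top.2 fun _ _ => ENNReal.ofReal_ne_top
  have hlim : Tendsto (fun ε : ℝ≥0 =>
      b' + ε * ∑ k, ENNReal.ofReal (maxMean ν θstar - mean ν k θstar)) (𝓝[>] 0) (𝓝 b') := by
    have h0 : Tendsto (fun ε : ℝ≥0 => (ε : ℝ≥0∞)) (𝓝[>] 0) (𝓝 0) :=
      (ENNReal.continuous_coe.tendsto' 0 0 rfl).mono_left nhdsWithin_le_nhds
    simpa using tendsto_const_nhds.add (ENNReal.Tendsto.mul_const h0 (Or.inr hS))
  exact ge_of_tendsto hlim (eventually_mem_nhdsWithin.mono fun ε hε => key ε hε)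

/-! ### When the constant vanishes and when it is positive -/

omit [∀ θ, IsMarkovKernel (ν θ)] in
lemma confusing_eq_empty (hopt : IsOptimal ν θstar kstar)
    (h : numCompetitive ν θstar kstar = 1) : confusing ν θstar kstar = ∅ := by
  obtain ⟨j, hj⟩ := Set.ncard_eq_one.1 h
  have hstar : kstar = j := hj.subset (show IsCompetitive ν _ kstar from ⟨θstar, rfl, hopt⟩)
  refine Set.eq_empty_of_forall_notMem fun lam hlam => hlam.2 ?_
  obtain ⟨i, hi⟩ := exists_isOptimal ν lam kstar
  have hij : i = j := hj.subset (show IsCompetitive ν _ i from ⟨lam, hlam.1, hi⟩)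
  rwa [hstar, ← hij]

omit [∀ θ, IsMarkovKernel (ν θ)] in
lemma lowerBoundConst_eq_zero (h : confusing ν θstar kstar = ∅) :
    lowerBoundConst ν θstar kstar = 0 := by
  refine le_antisymm ((iInf₂_le 0 ?_).trans (by simp)) (zero_le)
  intro lam hlam
  simp [h] at hlam

lemma lowerBoundConst_pos
    (hparam : ∀ θ lam, mean ν kstar θ = mean ν kstar lam → ν θ kstar = ν lam kstar)
    (hopt : ∀ k, k ≠ kstar → mean ν k θstar < mean ν kstar θstar) {lam : Θ}
    (hlam : lam ∈ confusing ν θstar kstar) (hfin : ∀ k, klDiv (ν θstar k) (ν lam k) ≠ ∞) :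
    0 < lowerBoundConst ν θstar kstar := by
  have hstar : mean ν kstar θstar = maxMean ν θstar := IsOptimal.of_forall_lt ν hopt
  set gap : Fin K → ℝ≥0∞ := fun k => ENNReal.ofReal (maxMean ν θstar - mean ν k θstar) with hgapdef
  have hgap : ∀ k, k ≠ kstar → gap k ≠ 0 :=
    fun k hk => by simpa [hgapdef, ← hstar] using hopt k hk
  -- `M` is chosen so that each divergence is at most `M` times the gap; every feasible rate then
  -- costs at least `M⁻¹`. The arm `kstar` is left out, its gap and divergence both being zero.
  set M : ℝ≥0∞ := ∑ k ∈ Finset.univ.erase kstar, klDiv (ν θstar k) (ν lam k) / gap k with hM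
  have hMtop : M ≠ ∞ := ENNReal.sum_ne_top.2 fun k hk =>
    ENNReal.div_ne_top (hfin k) (hgap k (Finset.ne_of_mem_erase hk))
  have hle : ∀ k, klDiv (ν θstar k) (ν lam k) ≤ M * gap k := by
    intro k
    by_cases hk : k = kstar
    · subst hk
      simp [hparam θstar lam hlam.1.symm]
    · rw [← ENNReal.div_le_iff (hgap k hk) ENNReal.ofReal_ne_top]
      exact Finset.single_le_sum (f := fun k => klDiv (ν θstar k) (ν lam k) / gap k)
        (fun _ _ => zero_le) (Finset.mem_erase.2 ⟨hk, Finset.mem_univ k⟩)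
  refine (ENNReal.inv_pos.2 hMtop).trans_le (le_iInf₂ fun η hη => ?_)
  rw [← one_div]
  refine ENNReal.div_le_of_le_mul ?_
  refine (hη lam hlam).trans ?_
  rw [Finset.sum_mul]
  refine Finset.sum_le_sum fun k _ => ?_
  calc (η k : ℝ≥0∞) * klDiv (ν θstar k) (ν lam k) ≤ η k * (M * gap k) := by gcongr; exact hle k
    _ = _ := by ring

omit [∀ θ, IsMarkovKernel (ν θ)] in
lemma liminf_regret_div_log_eq_zero {B : ℝ} (hB : ∀ T : ℕ, regret ν π θstar T ≤ B) :
    liminf (fun T : ℕ => ENNReal.ofReal (regret ν π θstar T / Real.log T)) atTop = 0 := by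
  have hlim : Tendsto (fun T : ℕ => ENNReal.ofReal (B / Real.log T)) atTop (𝓝 0) := by
    have : Tendsto (fun T : ℕ => B / Real.log T) atTop (𝓝 0) :=
      tendsto_const_nhds.div_atTop (Real.tendsto_log_atTop.comp tendsto_natCast_atTop_atTop)
    simpa using ENNReal.tendsto_ofReal this
  refine (tendsto_of_tendsto_of_tendsto_of_le_of_le tendsto_const_nhds hlim
    (fun _ => zero_le) fun T => ENNReal.ofReal_le_ofReal ?_).liminf_eq
  exact div_le_div_of_nonneg_right (hB T) (Real.log_natCast_nonneg T)

end StructuredBandit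

theorem proposition1 {K : ℕ} {Θ : Type*}
    (ν : Θ → Kernel (Fin K) ℝ) [∀ θ, IsMarkovKernel (ν θ)]
    -- the rewards are sub-Gaussian with variance proxy `σ ^ 2`
    (σ : ℝ≥0)
    (hsub : ∀ θ k, HasSubgaussianMGF (fun x => x - StructuredBandit.mean ν k θ) (σ ^ 2) (ν θ k))
    -- the reward law of an arm is parameterized by its mean
    (hparam : ∀ k θ lam,
      StructuredBandit.mean ν k θ = StructuredBandit.mean ν k lam → ν θ k = ν lam k)
    -- `kstar` is the optimal arm under the true parameter `θstar`
    (θstar : Θ) (kstar : Fin K)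
    (hopt : ∀ k, k ≠ kstar → StructuredBandit.mean ν k θstar < StructuredBandit.mean ν kstar θstar) :
    (∀ π : StructuredBandit.Algorithm K, StructuredBandit.UniformlyGood ν π →
      StructuredBandit.lowerBoundConst ν θstar kstar ≤
        liminf (fun T : ℕ =>
          ENNReal.ofReal (StructuredBandit.regret ν π θstar T / Real.log T)) atTop) ∧
    (StructuredBandit.numCompetitive ν θstar kstar = 1 →
      StructuredBandit.lowerBoundConst ν θstar kstar = 0) ∧
    -- positivity, when optimality of `kstar` is never shared on `Θ*` and divergences are finite
    ((∀ θ ∈ StructuredBandit.thetaStar ν θstar kstar, StructuredBandit.IsOptimal ν θ kstar →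
        ∀ k, k ≠ kstar → ¬ StructuredBandit.IsOptimal ν θ k) →
      (∀ θ ∈ StructuredBandit.thetaStar ν θstar kstar, ∀ k, klDiv (ν θstar k) (ν θ k) ≠ ∞) →
      (1 < StructuredBandit.numCompetitive ν θstar kstar →
        0 < StructuredBandit.lowerBoundConst ν θstar kstar) ∧
      ∀ π : StructuredBandit.Algorithm K, StructuredBandit.UniformlyGood ν π →
        (∃ B : ℝ, ∀ T : ℕ, StructuredBandit.regret ν π θstar T ≤ B) →
        StructuredBandit.numCompetitive ν θstar kstar = 1) := by
  have hstar : StructuredBandit.IsOptimal ν θstar kstar :=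
    StructuredBandit.IsOptimal.of_forall_lt ν hopt
  refine ⟨fun π hπ => hπ.lowerBoundConst_le_liminf (hparam kstar) hopt,
    fun h => StructuredBandit.lowerBoundConst_eq_zero
      (StructuredBandit.confusing_eq_empty hstar h), fun hshare hfin => ?_⟩
  have hpos : 1 < StructuredBandit.numCompetitive ν θstar kstar →
      0 < StructuredBandit.lowerBoundConst ν θstar kstar := by
    intro h
    -- A second competitive arm is optimal at some `lam` in `Θ*`; as optimality is not shared there,
    -- `kstar` is suboptimal and `lam` is confusing.
    obtain ⟨k, ⟨lam, hlam, hk⟩, hne⟩ := Set.exists_ne_of_one_lt_ncard h kstar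
    exact StructuredBandit.lowerBoundConst_pos (hparam kstar) hopt
      ⟨hlam, fun hk' => hshare lam hlam hk' k hne hk⟩ (hfin lam hlam)
  refine ⟨hpos, fun π hπ ⟨B, hB⟩ => le_antisymm (not_lt.1 fun h => ?_) ?_⟩
  · have h1 := hπ.lowerBoundConst_le_liminf (hparam kstar) hopt
    rw [StructuredBandit.liminf_regret_div_log_eq_zero hB] at h1
    exact (hpos h).not_ge h1
  · exact (Set.ncard_pos (Set.toFinite _)).2 ⟨kstar, θstar, rfl, hstar⟩
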